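/- For $s\in\{0,1\}^n$ let $x\cdot s=\sum_i x_is_i \bmod 2$, and let $P_s$ be the distribution on $\{0,1\}^{n+1}$ with $P_s(x,y)=2^{-n}$ if $y=x\cdot s$ and $P_s(x,y)=0$ otherwise ($x\in\{0,1\}^n$, $y\in\{0,1\}$). A $Z$-basis observable on $N$ qubits is a real diagonal operator in the computational basis of operator norm at most $1$; for example, the Pauli strings $Z^b=Z^{b_1}\otimes\dots\otimes Z^{b_N}$, $b\in\{0,1\}^N$. For a state vector $|\psi\rangle$ let $D_{|\psi\rangle}(z)=|\langle z|\psi\rangle|^2$. **Theorem.** There are Clifford circuits $\mathcal C_s$ on $n+1$ qubits ($n\ge 0$, $s\in\{0,1\}^n$) with clean output states $$|\psi_s\rangle=\mathcal C_s|0\rangle^{\otimes (n+1)}=2^{-n/2}\sum_{x\in\{0,1\}^n}|x,\,x\cdot s\rangle ,\qquad D_{|\psi_s\rangle}=P_s,$$ such that the following holds. For each $n$ let $\mathcal M_n$ be a set of $Z$-basis observables on $n+1$ qubits (for example $\mathcal M_n=\{Z^b\}_{b\in\{0,1\}^{n+1}}$), let $\tau_n>0$, and let $m_n\ge0$ and $k_n\ge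 1$ be integers with $m_n=o(\tau_n^2\,2^n)$ as $n\to\infty$ (the numbers $k_n$ are otherwise arbitrary; in particular $k_n=O(n)$ is allowed). Let $\delta<1$. Then for all sufficiently large $n$ there is no algorithm $\mathcal B$ with the following property: for every $s\in\{0,1\}^n$ and every table of estimates $(\hat o_O)_{O\in\mathcal M_n}$ with $|\hat o_O-\langle\psi_s|O|\psi_s\rangle|<\tau_n$ for all $O\in\mathcal M_n$, the algorithm $\mathcal B$, which is not told $s$ and reads only $m_n$ of these estimates, outputs $k_n$ independent samples from some distribution $p$ on $\{0,1\}^{n+1}$ with $$d_{TV}\big(p,D_{|\psi_s\rangle}\big)\le \tfrac1{16},$$ with probability at least $1-\delta$ over its internal coins. Here $\mathcal B$ is computationally unrestricted, may choose each observable adaptively depending on the estimates read so far, and may be randomized: it first draws (from a discrete distribution) internal coins, over which the success probability is measured and on which $p$ may depend, and may use further discrete randomness for its choice of observables and for its output, the output samples being independent with law $p$ with respect to this further randomness. -/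

import Mathlib

open Filter Asymptotics

namespace WeakToStrong

/-- Bit strings of length `N`; `ZMod 2` gives the inner product modulo 2. -/
abbrev Bits (N : ℕ) : Type := Fin N → ZMod 2

/-- State vectors of `N` qubits, in coordinates with respect to the computational basis. -/
abbrev StateVec (N : ℕ) : Type := Bits N → ℂ

/-- Operators on `N` qubits, as matrices in the computational basis. -/
abbrev Operator (N : ℕ) : Type := Matrix (Bits N) (Bits N) ℂ

/-! ### Clifford circuits -/

/-- The Hadamard matrix. -/
noncomputable def hadamard : Matrix (ZMod 2) (ZMod 2) ℂ :=
  Matrix.of fun a b => (1 / (Real.sqrt 2 : ℂ)) * (-1) ^ (a * b).val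

/-- The phase matrix `diag(1, i)`. -/
noncomputable def phase : Matrix (ZMod 2) (ZMod 2) ℂ :=
  Matrix.diagonal fun a => Complex.I ^ a.val

/-- The operator that applies the one-qubit operator `U` to qubit `i` and the identity to the
other qubits. -/
noncomputable def onQubit {N : ℕ} (i : Fin N) (U : Matrix (ZMod 2) (ZMod 2) ℂ) : Operator N :=
  Matrix.of fun x y => if ∀ j, j ≠ i → x j = y j then U (x i) (y i) else 0

/-- The controlled-NOT gate, `|y⟩ ↦ |y with y_t replaced by y_t + y_c⟩`. -/
noncomputable def cnotMatrix {N : ℕ} (c t : Fin N) : Operator N :=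
  Matrix.of fun x y => if x = Function.update y t (y t + y c) then 1 else 0

/-- The standard generating gates of the Clifford group on `N` qubits. -/
inductive CliffordGate (N : ℕ) : Type
  | H (i : Fin N) : CliffordGate N
  | S (i : Fin N) : CliffordGate N
  | CNOT (c t : Fin N) (h : c ≠ t) : CliffordGate N

/-- The unitary of a Clifford gate. -/
noncomputable def CliffordGate.matrix {N : ℕ} : CliffordGate N → Operator N
  | .H i => onQubit i hadamard
  | .S i => onQubit i phase
  | .CNOT c t _ => cnotMatrix c t

/-- A Clifford circuit: a finite sequence of gates, the head of the list being applied first. -/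
abbrev CliffordCircuit (N : ℕ) : Type := List (CliffordGate N)

/-- The unitary implemented by a Clifford circuit. -/
noncomputable def circuitMatrix {N : ℕ} : CliffordCircuit N → Operator N
  | [] => 1
  | g :: gs => circuitMatrix gs * g.matrix

/-- The clean output state vector `C |0…0⟩`. -/
noncomputable def outputState {N : ℕ} (C : CliffordCircuit N) : StateVec N :=
  Matrix.mulVec (circuitMatrix C) (Pi.single 0 1)

/-! ### Computational basis distribution, expectation values, observables -/

/-- The distribution of the outcome of a computational basis measurement of `ψ`. -/
noncomputable def basisDist {N : ℕ} (ψ : StateVec N) (z : Bits N) : ℝ := ‖ψ z‖ ^ 2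

/-- The expectation value `⟨ψ|O|ψ⟩` (a real number when `O` is Hermitian). -/
noncomputable def expect {N : ℕ} (O : Operator N) (ψ : StateVec N) : ℝ :=
  (dotProduct (star ψ) (Matrix.mulVec O ψ)).re

/-- The `Z`-basis observables: Hermitian operators with the computational basis as eigenbasis
(that is, real diagonal matrices) and operator norm at most one. -/
def zBasisObservables (N : ℕ) : Set (Operator N) :=
  {O | ∃ f : Bits N → ℝ, (∀ z, |f z| ≤ 1) ∧ O = Matrix.diagonal fun z => (f z : ℂ)}

/-- The Pauli matrix `Z`. -/
def pauliZ : Matrix (ZMod 2) (ZMod 2) ℂ := Matrix.diagonal fun a => (-1) ^ a.val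

/-- The Pauli string `Z^b`, the tensor product of the `Z^{b_i}`. -/
noncomputable def pauliZString {N : ℕ} (b : Bits N) : Operator N :=
  Matrix.of fun x y => ∏ i, (pauliZ ^ (b i).val) (x i) (y i)

/-- The strings `Z^b` are among the `Z`-basis observables. -/
theorem range_pauliZString_subset (N : ℕ) :
    Set.range (pauliZString (N := N)) ⊆ zBasisObservables N := by
  rintro _ ⟨b, rfl⟩
  refine ⟨fun z => ∏ i, ((-1 : ℝ) ^ (z i).val) ^ (b i).val, fun z => ?_, ?_⟩
  · rw [Finset.abs_prod]
    simp
  · ext x y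
    simp only [pauliZString, pauliZ, Matrix.of_apply, Matrix.diagonal_pow]
    by_cases h : x = y
    · subst h
      simp
    · obtain ⟨i, hi⟩ := Function.ne_iff.mp h
      rw [Matrix.diagonal_apply_ne _ h]
      exact Finset.prod_eq_zero (Finset.mem_univ i) (Matrix.diagonal_apply_ne _ hi)

/-! ### Parities -/

/-- The parity state `2^{-n/2} ∑ₓ |x, x·s⟩` on `n + 1` qubits. -/
noncomputable def parityState (n : ℕ) (s : Bits n) : StateVec (n + 1) :=
  (1 / (Real.sqrt (2 ^ n) : ℂ)) •
    ∑ x : Bits n, Pi.single (Fin.snoc (α := fun _ => ZMod 2) x (dotProduct x s)) 1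

/-- The parity distribution `P_s` on `n + 1` bits: the first `n` bits `x` are uniform and the
last bit is `x·s`. -/
noncomputable def parityDist (n : ℕ) (s : Bits n) (z : Bits (n + 1)) : ℝ :=
  if z (Fin.last n) = dotProduct (Fin.init z) s then 1 / 2 ^ n else 0

/-! ### Algorithms that see only estimates of expectation values -/

/-- A (possibly randomized) adaptive algorithm that may ask for the estimates of observables in
`𝓜` and has outputs in `α`. The next observable and the output are drawn from distributions that
depend arbitrarily on the list of observables asked and estimates received so far (most recent
first). -/
structure QueryAlgorithm {N : ℕ} (𝓜 : Set (Operator N)) (α : Type) where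
  nextQuery : List (𝓜 × ℝ) → PMF 𝓜
  output : List (𝓜 × ℝ) → PMF α

/-- The law of the output, when the history is `h` and `m` more estimates are asked for, all of
them taken from the table `est` of estimates. -/
noncomputable def QueryAlgorithm.outputLaw {N : ℕ} {𝓜 : Set (Operator N)} {α : Type}
    (A : QueryAlgorithm 𝓜 α) (est : 𝓜 → ℝ) : ℕ → List (𝓜 × ℝ) → PMF α
  | 0, h => A.output h
  | m + 1, h => (A.nextQuery h).bind fun O => A.outputLaw est m ((O, est O) :: h)

/-- A table of `τ`-accurate estimates of the expectation values in the state `ψ`: the output of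
weak error mitigation. -/
def IsAccurate {N : ℕ} {𝓜 : Set (Operator N)} (τ : ℝ) (ψ : StateVec N) (est : 𝓜 → ℝ) : Prop :=
  ∀ O : 𝓜, |est O - expect (O : Operator N) ψ| < τ

/-- Total variation distance of two distributions on a finite set. -/
noncomputable def tvDist {X : Type} [Fintype X] (p q : X → ℝ) : ℝ :=
  (1 / 2) * ∑ x, |p x - q x|

/-- `ν` is the law of `k` independent samples from some distribution `p` whose total variation
distance from `D` is at most `ε`. -/
def IsLawOfSamplesNear {N k : ℕ} (ε : ℝ) (D : Bits N → ℝ) (ν : PMF (Fin k → Bits N)) : Prop :=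
  ∃ p : PMF (Bits N), (∀ z, ν z = ∏ i, p (z i)) ∧ tvDist (fun z => (p z).toReal) D ≤ ε

/-- `B`, an algorithm drawn at random with internal coins, turns `m` adaptively chosen
`τ`-accurate estimates for observables in `𝓜` into `k` independent samples from a distribution
within `ε` of the computational basis distribution, with probability at least `1 - δ` over the
coins. It must do so for every circuit in the class `𝒞` and every table of accurate estimates,
and it knows of the circuit only the estimates it asks for. -/
def SamplesFromEstimates {N k : ℕ} {𝓜 : Set (Operator N)} (𝒞 : Set (CliffordCircuit N))
    (τ ε δ : ℝ) (m : ℕ) (B : PMF (QueryAlgorithm 𝓜 (Fin k → Bits N))) : Prop :=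
  ∀ C ∈ 𝒞, ∀ est : 𝓜 → ℝ, IsAccurate τ (outputState C) est →
    ENNReal.ofReal (1 - δ) ≤ B.toOuterMeasure
      {A | IsLawOfSamplesNear ε (basisDist (outputState C)) (A.outputLaw est m [])}

end WeakToStrong

open WeakToStrong

/-!
The sign characters `(x, y) ↦ (-1)^(y + x·s)`, which separate the support of `P_s` from its
complement, are orthogonal, and Bessel's inequality is used for them twice.

First, a `Z`-basis observable has expectation in `ψ_s` equal to its normalized trace plus its
correlation with the `s`-th character, so for at most `1 / τ²` of the `s` do the two differ by `τ`
or more. Let the estimates be the normalized traces wherever these are `τ`-accurate: then the output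
law of an algorithm depends on `s` only through the event that it asks for an observable
distinguishing `ψ_s`, and the expected numbers of such queries sum to at most `m / τ²` over all `s`.

Second, a single law `q` is within `ε < 1/2` of at most `2 / (1 - 2ε)²` of the `P_s`: truncated at
height `2⁻ⁿ`, it still has correlation at least `1 - 2ε` with the `s`-th character, but its squared
`ℓ²` norm is at most `2⁻ⁿ`.

So one algorithm succeeds for `O(1 + m / τ²)` of the `2ⁿ` strings `s`, and averaging over the coins
gives `2ⁿ (1 - δ) = O(1 + m / τ²)`.
-/

namespace WeakToStrong

open Matrix
open scoped ComplexConjugate ENNReal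

/-! ### Characters of finite abelian groups -/

section Characters

variable {G ι 𝕜 : Type*} [AddCommGroup G] [Fintype G] [RCLike 𝕜] {χ : ι → AddChar G 𝕜}

theorem orthonormal_smul_addChar (hχ : Function.Injective χ) :
    Orthonormal 𝕜 fun i => ((√(Fintype.card G) : ℝ) : 𝕜)⁻¹ • WithLp.toLp 2 (χ i : G → 𝕜) := by
  classical
  rw [orthonormal_iff_ite]
  intro i j
  have hij := AddChar.wInner_cWeight_eq_boole (χ i) (χ j)
  simp only [RCLike.wInner_cWeight_eq_smul_wInner_one, RCLike.wInner_one_eq_inner,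
    hχ.eq_iff] at hij
  rw [inner_smul_left, inner_smul_right, ← mul_assoc, ← hij, map_inv₀, RCLike.conj_ofReal,
    ← mul_inv, ← RCLike.ofReal_mul, Real.mul_self_sqrt (Nat.cast_nonneg _), RCLike.ofReal_natCast,
    NNRat.smul_def]
  simp

theorem sum_norm_sq_sum_mul_addChar_le (hχ : Function.Injective χ) (S : Finset ι) (f : G → 𝕜) :
    ∑ i ∈ S, ‖∑ z, f z * conj (χ i z)‖ ^ 2 ≤ Fintype.card G * ∑ z, ‖f z‖ ^ 2 := by
  have hG : (0 : ℝ) < Fintype.card G := Nat.cast_pos.mpr Fintype.card_pos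
  have hbessel := (orthonormal_smul_addChar hχ).sum_inner_products_le (WithLp.toLp 2 f) (s := S)
  simp only [inner_smul_left, norm_mul, mul_pow, EuclideanSpace.norm_sq_eq, ← Finset.mul_sum,
    PiLp.inner_apply, RCLike.inner_apply, map_inv₀, RCLike.conj_ofReal, norm_inv,
    RCLike.norm_ofReal, inv_pow, sq_abs, Real.sq_sqrt hG.le] at hbessel
  rwa [inv_mul_le_iff₀ hG] at hbessel

theorem card_mul_sq_le_of_le_norm_sum_mul_addChar (hχ : Function.Injective χ) {S : Finset ι}
    {f : G → 𝕜} {c : ℝ} (hc : 0 ≤ c) (hS : ∀ i ∈ S, c ≤ ‖∑ z, f z * conj (χ i z)‖) :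
    S.card * c ^ 2 ≤ Fintype.card G * ∑ z, ‖f z‖ ^ 2 := by
  refine le_trans ?_ (sum_norm_sq_sum_mul_addChar_le hχ S f)
  rw [← nsmul_eq_mul]
  exact S.card_nsmul_le_sum _ _ fun i hi => pow_le_pow_left₀ hc (hS i hi) 2

end Characters

/-! ### Total variation distance -/

section TotalVariation

theorem sum_toReal_coe {X : Type*} [Fintype X] (p : PMF X) : ∑ x, (p x).toReal = 1 := by
  rw [← ENNReal.toReal_sum fun x _ => p.apply_ne_top x, ← tsum_fintype (L := .unconditional X),
    p.tsum_coe, ENNReal.toReal_one]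

variable {X : Type} [Fintype X]

theorem tvDist_comm (p q : X → ℝ) : tvDist p q = tvDist q p := by
  simp only [tvDist, abs_sub_comm]

theorem tvDist_triangle (p q r : X → ℝ) : tvDist p r ≤ tvDist p q + tvDist q r := by
  rw [tvDist, tvDist, tvDist, ← mul_add, ← Finset.sum_add_distrib]
  gcongr
  exact abs_sub_le _ _ _

theorem tvDist_le_of_toOuterMeasure_le {p q : PMF X} {a : ℝ} (ha : 0 ≤ a)
    (h : ∀ T, p.toOuterMeasure T ≤ q.toOuterMeasure T + ENNReal.ofReal a) :
    tvDist (fun x => (p x).toReal) (fun x => (q x).toReal) ≤ a := by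
  classical
  let T : Finset X := {x | (q x).toReal ≤ (p x).toReal}
  have hT : ∑ x ∈ T, ((p x).toReal - (q x).toReal) ≤ a := by
    have hreal := ENNReal.toReal_mono (by
      rw [PMF.toOuterMeasure_apply_finset]
      exact ENNReal.add_ne_top.mpr
        ⟨ENNReal.sum_ne_top.mpr fun x _ => q.apply_ne_top x, ENNReal.ofReal_ne_top⟩) (h T)
    rw [PMF.toOuterMeasure_apply_finset, PMF.toOuterMeasure_apply_finset, ENNReal.toReal_add
      (ENNReal.sum_ne_top.mpr fun x _ => q.apply_ne_top x) ENNReal.ofReal_ne_top,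
      ENNReal.toReal_sum fun x _ => p.apply_ne_top x,
      ENNReal.toReal_sum fun x _ => q.apply_ne_top x, ENNReal.toReal_ofReal ha] at hreal
    rw [Finset.sum_sub_distrib]
    linarith
  have habs : ∀ x, |(p x).toReal - (q x).toReal| =
      2 * (if x ∈ T then (p x).toReal - (q x).toReal else 0) -
        ((p x).toReal - (q x).toReal) := by
    intro x
    simp only [T, Finset.mem_filter_univ]
    split_ifs with hx
    · rw [abs_of_nonneg (sub_nonneg.mpr hx)]
      ring
    · rw [abs_of_neg (sub_neg.mpr (not_le.mp hx))]
      ring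
  simp only [tvDist, habs, Finset.sum_sub_distrib, ← Finset.mul_sum, sum_toReal_coe,
    ← Finset.sum_filter, Finset.filter_univ_mem] at hT ⊢
  linarith

end TotalVariation

theorem map_eval_eq_of_eq_prod {X : Type*} [Finite X] {k : ℕ} {p : PMF X}
    {ν : PMF (Fin k → X)} (hν : ∀ z, ν z = ∏ i, p (z i)) (i₀ : Fin k) :
    ν.map (· i₀) = p := by
  classical
  have := Fintype.ofFinite X
  ext x
  let slice : Fin k → Finset X := fun i => {y | i = i₀ → x = y}
  have hslice : ({z | x = z i₀} : Finset (Fin k → X)) = Fintype.piFinset slice := by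
    ext z
    simp [slice, Fintype.mem_piFinset]
  calc ν.map (· i₀) x = ∑ z ∈ Fintype.piFinset slice, ∏ i, p (z i) := by
        rw [PMF.map_apply, tsum_fintype, ← Finset.sum_filter, hslice]
        exact Finset.sum_congr rfl fun z _ => hν z
    _ = ∏ i, ∑ y ∈ slice i, p y := (Finset.prod_univ_sum slice fun _ => p).symm
    _ = ∏ i, if i = i₀ then p x else 1 := Finset.prod_congr rfl fun i _ => by
        by_cases hi : i = i₀
        · simp [slice, hi, Finset.filter_eq]
        · simpa [slice, hi] using (tsum_fintype _).symm.trans p.tsum_coe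
    _ = p x := by simp

theorem IsLawOfSamplesNear.tvDist_map_eval_le {N k : ℕ} {ε : ℝ} {D : Bits N → ℝ}
    {ν : PMF (Fin k → Bits N)} (h : IsLawOfSamplesNear ε D ν) (i₀ : Fin k) :
    tvDist (fun z => (ν.map (· i₀) z).toReal) D ≤ ε := by
  obtain ⟨p, hν, hp⟩ := h
  rwa [map_eval_eq_of_eq_prod hν i₀]

/-! ### Parity distributions -/

section Parity

variable {n : ℕ}

/-- The `±1`-valued character `(x, y) ↦ (-1)^(y + x·s)`, which is `1` exactly on the support of
`parityDist n s`. -/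
noncomputable def paritySign (s : Bits n) : AddChar (Bits (n + 1)) ℝ :=
  (AddChar.zmodChar 2 (neg_one_sq (R := ℝ))).compAddMonoidHom <|
    AddMonoidHom.mk' (fun z => z (Fin.last n) + Fin.init z ⬝ᵥ s) fun z w => by
      simp [dotProduct, Fin.init, add_mul, Finset.sum_add_distrib, add_add_add_comm]

theorem paritySign_apply (s : Bits n) (z : Bits (n + 1)) :
    paritySign s z = if z (Fin.last n) = Fin.init z ⬝ᵥ s then 1 else -1 := by
  simp only [paritySign, AddChar.compAddMonoidHom_apply, AddMonoidHom.mk'_apply,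
    AddChar.zmodChar_apply, ← CharTwo.add_eq_zero (a := z (Fin.last n))]
  rcases (by decide : ∀ a : ZMod 2, a = 0 ∨ a = 1) (z (Fin.last n) + Fin.init z ⬝ᵥ s) with h | h <;>
    simp [h, ZMod.val_one]

theorem paritySign_injective : Function.Injective (paritySign (n := n)) := by
  intro s t hst
  ext i
  have h := DFunLike.congr_fun hst (Fin.snoc (α := fun _ => ZMod 2) (Pi.single i 1) (s i))
  simp only [paritySign_apply, Fin.snoc_last, Fin.init_snoc, single_one_dotProduct,
    if_true] at h
  by_contra hne
  norm_num [hne] at h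

theorem parityDist_eq_paritySign (s : Bits n) (z : Bits (n + 1)) :
    parityDist n s z = (1 + paritySign s z) / 2 ^ (n + 1) := by
  rw [parityDist, paritySign_apply]
  split_ifs
  · rw [pow_succ]
    field_simp
    norm_num
  · simp

theorem sum_paritySign (s : Bits n) : ∑ z, paritySign s z = 0 := by
  rw [AddChar.sum_eq_zero_iff_ne_zero, AddChar.ne_zero_iff]
  refine ⟨Pi.single (Fin.last n) 1, ?_⟩
  have hinit : Fin.init (Pi.single (Fin.last n) 1 : Bits (n + 1)) = 0 := by
    ext i
    simp [Fin.init]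
  rw [paritySign_apply, hinit]
  norm_num

theorem sum_parityDist (s : Bits n) : ∑ z, parityDist n s z = 1 := by
  simp only [parityDist_eq_paritySign, ← Finset.sum_div, Finset.sum_add_distrib, sum_paritySign]
  simp

/-- Truncating `q` at height `2⁻ⁿ` keeps all the mass that `q` shares with `parityDist n s`, so it
preserves the correlation with the parity while making the `ℓ²` norm small. -/
theorem one_sub_two_mul_tvDist_le_sum (q : Bits (n + 1) → ℝ) (s : Bits n) :
    1 - 2 * tvDist q (parityDist n s) ≤ ∑ z, min (q z) (1 / 2 ^ n) * paritySign s z := by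
  have hpoint : ∀ z, parityDist n s z - |q z - parityDist n s z| ≤
      min (q z) (1 / 2 ^ n) * paritySign s z := by
    intro z
    rw [parityDist, paritySign_apply]
    split_ifs
    · rw [mul_one, le_min_iff]
      constructor <;> linarith [neg_abs_le (q z - 1 / 2 ^ n), abs_nonneg (q z - 1 / 2 ^ n)]
    · rw [sub_zero]
      linarith [min_le_left (q z) (1 / 2 ^ n), le_abs_self (q z)]
  calc 1 - 2 * tvDist q (parityDist n s)
      = ∑ z, (parityDist n s z - |q z - parityDist n s z|) := by
        rw [Finset.sum_sub_distrib, sum_parityDist, tvDist]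
        ring
    _ ≤ _ := Finset.sum_le_sum fun z _ => hpoint z

theorem sum_min_sq_le {X : Type*} [Fintype X] {q : X → ℝ} (hq : ∀ x, 0 ≤ q x) {u : ℝ}
    (hu : 0 ≤ u) : ∑ x, min (q x) u ^ 2 ≤ u * ∑ x, q x := by
  rw [Finset.mul_sum]
  refine Finset.sum_le_sum fun x _ => ?_
  rw [sq]
  exact mul_le_mul (min_le_right _ _) (min_le_left _ _) (le_min (hq x) hu) hu

open Classical in
theorem card_tvDist_parityDist_le {ε : ℝ} (hε : ε < 1 / 2) (q : PMF (Bits (n + 1))) :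
    (Finset.card {s | tvDist (fun z => (q z).toReal) (parityDist n s) ≤ ε} : ℝ) ≤
      2 / (1 - 2 * ε) ^ 2 := by
  have hcard := card_mul_sq_le_of_le_norm_sum_mul_addChar (paritySign_injective (n := n))
    (S := {s | tvDist (fun z => (q z).toReal) (parityDist n s) ≤ ε})
    (f := fun z => min (q z).toReal (1 / 2 ^ n)) (c := 1 - 2 * ε) (by linarith) fun s hs => by
      rw [Finset.mem_filter_univ] at hs
      simp only [conj_trivial]
      refine le_trans ?_ (le_abs_self _)
      linarith [one_sub_two_mul_tvDist_le_sum (fun z => (q z).toReal) s]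
  have hmass := sum_min_sq_le (fun z => (q z).toReal_nonneg) (one_div_nonneg.mpr
    (pow_nonneg zero_le_two n))
  rw [sum_toReal_coe, mul_one] at hmass
  rw [le_div_iff₀ (pow_pos (by linarith) 2)]
  refine hcard.trans ?_
  simp only [Real.norm_eq_abs, sq_abs]
  calc (Fintype.card (Bits (n + 1)) : ℝ) * ∑ z, min (q z).toReal (1 / 2 ^ n) ^ 2
      ≤ 2 ^ (n + 1) * (1 / 2 ^ n) := by
        simp only [Fintype.card_pi, ZMod.card, Finset.prod_const, Finset.card_fin, Nat.cast_pow,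
          Nat.cast_ofNat]
        gcongr
    _ = 2 := by
        rw [pow_succ]
        field_simp

end Parity

/-! ### Preparation of the parity states -/

section Circuits

variable {N n : ℕ}

theorem circuitMatrix_append (C₁ C₂ : CliffordCircuit N) :
    circuitMatrix (C₁ ++ C₂) = circuitMatrix C₂ * circuitMatrix C₁ := by
  induction C₁ with
  | nil => simp [circuitMatrix]
  | cons g gs ih => simp [circuitMatrix, ih, Matrix.mul_assoc]

theorem onQubit_mulVec (i : Fin N) (U : Matrix (ZMod 2) (ZMod 2) ℂ) (ψ : StateVec N)
    (x : Bits N) : (onQubit i U *ᵥ ψ) x = ∑ b, U (x i) b * ψ (Function.update x i b) := by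
  let line : ZMod 2 ↪ Bits N := ⟨Function.update x i, Function.update_injective x i⟩
  have hline : ∀ y : Bits N, y ∉ Finset.univ.map line → ¬ ∀ j, j ≠ i → x j = y j := by
    refine fun y hy h => hy (Finset.mem_map.mpr ⟨y i, Finset.mem_univ _, ?_⟩)
    exact Function.update_eq_iff.mpr ⟨rfl, h⟩
  simp only [mulVec, dotProduct, onQubit, of_apply]
  rw [← Finset.sum_subset (Finset.subset_univ (Finset.univ.map line)) fun y _ hy => by
    rw [if_neg (hline y hy), zero_mul], Finset.sum_map]
  refine Finset.sum_congr rfl fun b _ => ?_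
  have hagree : ∀ j, j ≠ i → x j = Function.update x i b j := fun j hj => by simp [hj]
  simp only [line, Function.Embedding.coeFn_mk, if_pos hagree, Function.update_self]

theorem update_add_involutive {c t : Fin N} (h : c ≠ t) :
    Function.Involutive fun x : Bits N => Function.update x t (x t + x c) := by
  intro x
  simp [h, add_assoc, CharTwo.add_self_eq_zero]

theorem cnotMatrix_mulVec {c t : Fin N} (h : c ≠ t) (ψ : StateVec N) (x : Bits N) :
    (cnotMatrix c t *ᵥ ψ) x = ψ (Function.update x t (x t + x c)) := by
  simp [mulVec, dotProduct, cnotMatrix, ← (update_add_involutive h).eq_iff]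

/-- The uniform superposition of the basis states whose bits outside `S` vanish: the result of
applying Hadamard gates to the qubits in `S` of `|0…0⟩`. -/
noncomputable def uniformOn (S : Finset (Fin N)) : StateVec N :=
  fun z => (1 / (√2 : ℂ)) ^ S.card * if ∀ i, i ∉ S → z i = 0 then 1 else 0

theorem uniformOn_empty : uniformOn (∅ : Finset (Fin N)) = Pi.single 0 1 := by
  ext z
  simp only [uniformOn, Pi.single_apply, funext_iff]
  simp

theorem onQubit_hadamard_mulVec_uniformOn {S : Finset (Fin N)} {i : Fin N} (hi : i ∉ S) :
    onQubit i hadamard *ᵥ uniformOn S = uniformOn (insert i S) := by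
  ext x
  have hzero : ∀ b : ZMod 2, (∀ j, j ∉ S → Function.update x i b j = 0) ↔
      b = 0 ∧ ∀ j, j ∉ insert i S → x j = 0 := by
    intro b
    constructor
    · intro h
      refine ⟨by simpa using h i hi, fun j hj => ?_⟩
      rw [Finset.mem_insert, not_or] at hj
      simpa [hj.1] using h j hj.2
    · rintro ⟨rfl, h⟩ j hj
      by_cases hji : j = i
      · subst hji
        simp
      · simpa [hji] using h j (by simp [hji, hj])
  rw [onQubit_mulVec, Finset.sum_eq_single 0]
  · simp only [uniformOn, hzero, hadamard, of_apply, mul_zero, ZMod.val_zero, pow_zero, true_and,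
      Finset.card_insert_of_notMem hi]
    ring
  · intro b _ hb
    simp [uniformOn, hzero, hb]
  · simp

theorem circuitMatrix_map_H_mulVec_uniformOn {l : List (Fin N)} {S : Finset (Fin N)}
    (hl : l.Nodup) (hS : ∀ i ∈ l, i ∉ S) :
    circuitMatrix (l.map .H) *ᵥ uniformOn S = uniformOn (l.toFinset ∪ S) := by
  induction l generalizing S with
  | nil => simp [circuitMatrix]
  | cons i l ih =>
    rw [List.nodup_cons] at hl
    rw [List.forall_mem_cons] at hS
    have hiS : ∀ j ∈ l, j ∉ insert i S := fun j hj hmem =>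
      (Finset.mem_insert.mp hmem).elim (fun h => hl.1 (h ▸ hj)) (hS.2 j hj)
    rw [List.map_cons, circuitMatrix, ← mulVec_mulVec, CliffordGate.matrix,
      onQubit_hadamard_mulVec_uniformOn hS.1, ih hl.2 hiS, List.toFinset_cons,
      Finset.insert_union, Finset.union_insert]

theorem circuitMatrix_map_CNOT_mulVec {ι : Type*} {c : ι → Fin N} {t : Fin N}
    (hc : ∀ i, c i ≠ t) (l : List ι) (ψ : StateVec N) :
    circuitMatrix (l.map fun i => .CNOT (c i) t (hc i)) *ᵥ ψ =
      fun z => ψ (Function.update z t (z t + (l.map fun i => z (c i)).sum)) := by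
  induction l generalizing ψ with
  | nil => simp [circuitMatrix]
  | cons i l ih =>
    ext z
    rw [List.map_cons, circuitMatrix, ← mulVec_mulVec, ih, CliffordGate.matrix]
    simp only [cnotMatrix_mulVec (hc i)]
    simp [hc i, add_comm, add_left_comm]

/-- The Clifford circuit that prepares the parity state: Hadamard gates on the first `n` qubits,
then controlled-NOT gates from the qubits in the support of `s` to the last one. -/
noncomputable def parityCircuit (s : Bits n) : CliffordCircuit (n + 1) :=
  (Finset.univ.erase (Fin.last n)).toList.map .H ++
    (Finset.univ.filter (s · = 1)).toList.map fun i =>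
      .CNOT i.castSucc (Fin.last n) (Fin.castSucc_ne_last i)

theorem parityState_apply (s : Bits n) (z : Bits (n + 1)) :
    parityState n s z =
      (1 / (√(2 ^ n) : ℂ)) * if z (Fin.last n) = Fin.init z ⬝ᵥ s then 1 else 0 := by
  have hsnoc : ∀ x : Bits n, z = Fin.snoc (α := fun _ => ZMod 2) x (x ⬝ᵥ s) ↔
      Fin.init z = x ∧ z (Fin.last n) = Fin.init z ⬝ᵥ s := by
    intro x
    constructor
    · intro h
      rw [h]
      simp
    · rintro ⟨rfl, h⟩
      rw [← h, Fin.snoc_init_self]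
  simp [parityState, Finset.sum_apply, Pi.single_apply, hsnoc, ite_and]

theorem sum_map_toList_support (s x : Bits n) :
    ((Finset.univ.filter (s · = 1)).toList.map x).sum = x ⬝ᵥ s := by
  rw [Finset.sum_map_toList, Finset.sum_filter, dotProduct]
  refine Finset.sum_congr rfl fun i _ => ?_
  rcases (by decide : ∀ a : ZMod 2, a = 0 ∨ a = 1) (s i) with h | h <;> simp [h]

theorem outputState_parityCircuit (s : Bits n) :
    outputState (parityCircuit s) = parityState n s := by
  rw [outputState, parityCircuit, circuitMatrix_append, ← mulVec_mulVec, ← uniformOn_empty,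
    circuitMatrix_map_H_mulVec_uniformOn (Finset.nodup_toList _) (by simp),
    circuitMatrix_map_CNOT_mulVec]
  ext z
  have hparity : (∀ i, i = Fin.last n → Function.update z (Fin.last n)
      (z (Fin.last n) + Fin.init z ⬝ᵥ s) i = 0) ↔ z (Fin.last n) = Fin.init z ⬝ᵥ s := by
    rw [forall_eq, Function.update_self, CharTwo.add_eq_zero]
  have hsum : ((Finset.univ.filter (s · = 1)).toList.map fun i => z i.castSucc).sum =
      Fin.init z ⬝ᵥ s :=
    sum_map_toList_support s (Fin.init z)
  have hsqrt : √((2 : ℝ) ^ n) = √2 ^ n := by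
    rw [Real.sqrt_eq_iff_eq_sq (by positivity) (by positivity), ← pow_mul, mul_comm, pow_mul,
      Real.sq_sqrt zero_le_two]
  simp only [parityState_apply, hsum, uniformOn, Finset.union_empty, Finset.toList_toFinset,
    Finset.mem_erase, Finset.mem_univ, and_true, not_not, hparity, Finset.card_erase_of_mem,
    Finset.card_univ, Fintype.card_fin, Nat.add_sub_cancel, hsqrt, Complex.ofReal_pow,
    one_div, inv_pow]

theorem basisDist_parityState (s : Bits n) : basisDist (parityState n s) = parityDist n s := by
  ext z
  rw [basisDist, parityState_apply, parityDist]
  split_ifs <;> simp [Real.sq_sqrt]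

end Circuits

/-! ### Adaptive algorithms and tables of estimates -/

section Queries

theorem toOuterMeasure_le_one {α : Type*} (p : PMF α) (T : Set α) : p.toOuterMeasure T ≤ 1 := by
  rw [PMF.toOuterMeasure_apply, ← p.tsum_coe]
  exact ENNReal.tsum_le_tsum fun a => Set.indicator_le_self T p a

open Classical in
theorem sum_toOuterMeasure_le {α ι : Type*} [Fintype ι] (p : PMF α) {T : ι → Set α} {K : ℝ}
    (hK : ∀ a, (Finset.card {i | a ∈ T i} : ℝ) ≤ K) :
    ∑ i, p.toOuterMeasure (T i) ≤ ENNReal.ofReal K := by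
  calc ∑ i, p.toOuterMeasure (T i) = ∑' a, ∑ i, (T i).indicator p a := by
        simp only [PMF.toOuterMeasure_apply]
        exact (Summable.tsum_finsetSum fun _ _ => ENNReal.summable).symm
    _ ≤ ∑' a, ENNReal.ofReal K * p a := by
        refine ENNReal.tsum_le_tsum fun a => ?_
        simp only [Set.indicator_apply, ← Finset.sum_filter, Finset.sum_const, nsmul_eq_mul]
        gcongr
        rw [← ENNReal.ofReal_natCast]
        exact ENNReal.ofReal_le_ofReal (hK a)
    _ = ENNReal.ofReal K := by rw [ENNReal.tsum_mul_left, p.tsum_coe, mul_one]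

variable {N : ℕ} {𝓜 : Set (Operator N)} {ι : Type*} {τ : ℝ}

/-- The expected number of queries in the set `bad`, when the history is `h` and `m` more
estimates are asked for, all of them taken from the table `est`. -/
noncomputable def QueryAlgorithm.expectedHits {α : Type} (A : QueryAlgorithm 𝓜 α) (est : 𝓜 → ℝ)
    (bad : Set 𝓜) : ℕ → List (𝓜 × ℝ) → ℝ≥0∞
  | 0, _ => 0
  | m + 1, h => (A.nextQuery h).toOuterMeasure bad +
      ∑' O, A.nextQuery h O * A.expectedHits est bad m ((O, est O) :: h)

theorem QueryAlgorithm.toOuterMeasure_outputLaw_le_add_expectedHits {α : Type}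
    (A : QueryAlgorithm 𝓜 α) {e e' : 𝓜 → ℝ} {bad : Set 𝓜} (hee : ∀ O, O ∉ bad → e' O = e O)
    (T : Set α) (m : ℕ) (h : List (𝓜 × ℝ)) :
    (A.outputLaw e' m h).toOuterMeasure T ≤
      (A.outputLaw e m h).toOuterMeasure T + A.expectedHits e bad m h := by
  induction m generalizing h with
  | zero => simp [outputLaw, expectedHits]
  | succ m ih =>
    simp only [outputLaw, expectedHits, PMF.toOuterMeasure_bind_apply,
      PMF.toOuterMeasure_apply _ bad, ← ENNReal.tsum_add]
    refine ENNReal.tsum_le_tsum fun O => ?_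
    by_cases hO : O ∈ bad
    · rw [Set.indicator_of_mem hO, add_left_comm]
      exact (mul_le_of_le_one_right' (toOuterMeasure_le_one _ _)).trans le_self_add
    · rw [Set.indicator_of_notMem hO, zero_add, hee O hO, ← mul_add]
      gcongr
      exact ih _

open Classical in
theorem QueryAlgorithm.sum_expectedHits_le {α : Type} [Fintype ι] (A : QueryAlgorithm 𝓜 α)
    (e : 𝓜 → ℝ) {bad : ι → Set 𝓜} {K : ℝ} (hK : ∀ O, (Finset.card {i | O ∈ bad i} : ℝ) ≤ K)
    (m : ℕ) (h : List (𝓜 × ℝ)) :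
    ∑ i, A.expectedHits e (bad i) m h ≤ m * ENNReal.ofReal K := by
  induction m generalizing h with
  | zero => simp [expectedHits]
  | succ m ih =>
    have hlater : ∑ i, ∑' O, A.nextQuery h O * A.expectedHits e (bad i) m ((O, e O) :: h) ≤
        m * ENNReal.ofReal K := by
      rw [← Summable.tsum_finsetSum fun _ _ => ENNReal.summable]
      calc ∑' O, ∑ i, A.nextQuery h O * A.expectedHits e (bad i) m ((O, e O) :: h)
          ≤ ∑' O, A.nextQuery h O * (m * ENNReal.ofReal K) := by
            refine ENNReal.tsum_le_tsum fun O => ?_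
            rw [← Finset.mul_sum]
            gcongr
            exact ih _
        _ = m * ENNReal.ofReal K := by
            rw [ENNReal.tsum_mul_right, PMF.tsum_coe, one_mul]
    simp only [expectedHits, Finset.sum_add_distrib]
    rw [Nat.cast_succ, add_one_mul, add_comm]
    exact add_le_add hlater (sum_toOuterMeasure_le _ hK)

/-- The observables whose expectation value in `ψ` is not within `τ` of the reference value given
by the table `e`. -/
def distinguishing (e : 𝓜 → ℝ) (τ : ℝ) (ψ : StateVec N) : Set 𝓜 :=
  {O | τ ≤ |e O - expect (O : Operator N) ψ|}

open Classical in
/-- The table of estimates for `ψ` that repeats the reference table `e` wherever this is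
`τ`-accurate, and is exact elsewhere. -/
noncomputable def maskedTable (e : 𝓜 → ℝ) (τ : ℝ) (ψ : StateVec N) (O : 𝓜) : ℝ :=
  if O ∈ distinguishing e τ ψ then expect (O : Operator N) ψ else e O

theorem isAccurate_maskedTable (e : 𝓜 → ℝ) (hτ : 0 < τ) (ψ : StateVec N) :
    IsAccurate τ ψ (maskedTable e τ ψ) := by
  intro O
  rw [maskedTable]
  split_ifs with h
  · simpa using hτ
  · exact not_le.mp h

theorem maskedTable_of_notMem {e : 𝓜 → ℝ} {ψ : StateVec N} {O : 𝓜}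
    (h : O ∉ distinguishing e τ ψ) : maskedTable e τ ψ O = e O :=
  if_neg h

theorem QueryAlgorithm.tvDist_map_eval_outputLaw_le {k : ℕ} {ε γ : ℝ}
    (A : QueryAlgorithm 𝓜 (Fin k → Bits N)) (i₀ : Fin k) (e : 𝓜 → ℝ) (m : ℕ) {ψ : StateVec N}
    (hγ : 0 ≤ γ) (hhits : A.expectedHits e (distinguishing e τ ψ) m [] ≤ ENNReal.ofReal γ)
    (h : IsLawOfSamplesNear ε (basisDist ψ) (A.outputLaw (maskedTable e τ ψ) m [])) :
    tvDist (fun z => ((A.outputLaw e m []).map (· i₀) z).toReal) (basisDist ψ) ≤ γ + ε := by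
  have hmap : ∀ T, ((A.outputLaw (maskedTable e τ ψ) m []).map (· i₀)).toOuterMeasure T ≤
      ((A.outputLaw e m []).map (· i₀)).toOuterMeasure T + ENNReal.ofReal γ := by
    intro T
    rw [PMF.toOuterMeasure_map_apply, PMF.toOuterMeasure_map_apply]
    refine (A.toOuterMeasure_outputLaw_le_add_expectedHits
      (fun O => maskedTable_of_notMem (τ := τ) (ψ := ψ)) _ m []).trans ?_
    gcongr
  refine (tvDist_triangle _ _ _).trans (add_le_add ?_ (h.tvDist_map_eval_le i₀))
  rw [tvDist_comm]
  exact tvDist_le_of_toOuterMeasure_le hγ hmap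

open Classical in
theorem QueryAlgorithm.card_isLawOfSamplesNear_le [Fintype ι] {k m : ℕ} {ε γ K L : ℝ}
    {ψ : ι → StateVec N} {e : 𝓜 → ℝ} (A : QueryAlgorithm 𝓜 (Fin k → Bits N)) (i₀ : Fin k)
    (hγ : 0 < γ)
    (hK : ∀ O, (Finset.card {i | O ∈ distinguishing e τ (ψ i)} : ℝ) ≤ K)
    (hL : ∀ q : PMF (Bits N), (Finset.card {i | tvDist (fun z => (q z).toReal)
      (basisDist (ψ i)) ≤ γ + ε} : ℝ) ≤ L) :
    (Finset.card {i | IsLawOfSamplesNear ε (basisDist (ψ i))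
      (A.outputLaw (maskedTable e τ (ψ i)) m [])} : ℝ) ≤ L + m * K / γ := by
  let hits : ι → ℝ≥0∞ := fun i => A.expectedHits e (distinguishing e τ (ψ i)) m []
  let q : PMF (Bits N) := (A.outputLaw e m []).map (· i₀)
  let close : Finset ι := {i | tvDist (fun z => (q z).toReal) (basisDist (ψ i)) ≤ γ + ε}
  let often : Finset ι := {i | ENNReal.ofReal γ ≤ hits i}
  have hoften : (often.card : ℝ) ≤ m * K / γ := by
    obtain ⟨O, -⟩ := (A.nextQuery []).support_nonempty
    have hK0 : 0 ≤ K := (Nat.cast_nonneg _).trans (hK O)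
    rw [le_div_iff₀ hγ, ← ENNReal.ofReal_le_ofReal_iff (by positivity),
      ENNReal.ofReal_mul (Nat.cast_nonneg _), ENNReal.ofReal_mul (Nat.cast_nonneg _),
      ENNReal.ofReal_natCast, ENNReal.ofReal_natCast]
    calc (often.card : ℝ≥0∞) * ENNReal.ofReal γ ≤ ∑ i ∈ often, hits i := by
          rw [← nsmul_eq_mul]
          exact Finset.card_nsmul_le_sum _ _ _ fun i hi => (Finset.mem_filter_univ i).mp hi
      _ ≤ ∑ i, hits i := Finset.sum_le_sum_of_subset (Finset.subset_univ _)
      _ ≤ m * ENNReal.ofReal K := A.sum_expectedHits_le e hK m []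
  have hcover : ({i | IsLawOfSamplesNear ε (basisDist (ψ i))
      (A.outputLaw (maskedTable e τ (ψ i)) m [])} : Finset ι) ⊆ close ∪ often := by
    intro i hi
    rw [Finset.mem_filter_univ] at hi
    rw [Finset.mem_union, Finset.mem_filter_univ, Finset.mem_filter_univ]
    exact (le_total (hits i) (ENNReal.ofReal γ)).imp_left fun hhits =>
      A.tvDist_map_eval_outputLaw_le i₀ e m hγ.le hhits hi
  calc _ ≤ ((close ∪ often).card : ℝ) := by exact_mod_cast Finset.card_le_card hcover
    _ ≤ close.card + often.card := by exact_mod_cast Finset.card_union_le _ _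
    _ ≤ L + m * K / γ := add_le_add (hL q) hoften

open Classical in
theorem SamplesFromEstimates.card_mul_one_sub_le [Fintype ι] {k m : ℕ} {ε δ γ K L : ℝ}
    {C : ι → CliffordCircuit N} {B : PMF (QueryAlgorithm 𝓜 (Fin k → Bits N))}
    (hB : SamplesFromEstimates (Set.range C) τ ε δ m B) (hτ : 0 < τ) (i₀ : Fin k) {e : 𝓜 → ℝ}
    (hγ : 0 < γ)
    (hK : ∀ O, (Finset.card {i | O ∈ distinguishing e τ (outputState (C i))} : ℝ) ≤ K)
    (hL : ∀ q : PMF (Bits N), (Finset.card {i | tvDist (fun z => (q z).toReal)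
      (basisDist (outputState (C i))) ≤ γ + ε} : ℝ) ≤ L) :
    Fintype.card ι * (1 - δ) ≤ L + m * K / γ := by
  have hfew (A : QueryAlgorithm 𝓜 (Fin k → Bits N)) :=
    A.card_isLawOfSamplesNear_le (m := m) i₀ hγ hK hL
  obtain ⟨A, -⟩ := B.support_nonempty
  rw [← ENNReal.ofReal_le_ofReal_iff ((Nat.cast_nonneg _).trans (hfew A)),
    ENNReal.ofReal_mul (Nat.cast_nonneg _), ENNReal.ofReal_natCast]
  calc (Fintype.card ι : ℝ≥0∞) * ENNReal.ofReal (1 - δ) = ∑ _i : ι, ENNReal.ofReal (1 - δ) := by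
        rw [Finset.sum_const, nsmul_eq_mul, Finset.card_univ]
    _ ≤ ∑ i, B.toOuterMeasure {A | IsLawOfSamplesNear ε (basisDist (outputState (C i)))
          (A.outputLaw (maskedTable e τ (outputState (C i))) m [])} :=
        Finset.sum_le_sum fun i _ =>
          hB (C i) (Set.mem_range_self i) _ (isAccurate_maskedTable e hτ _)
    _ ≤ ENNReal.ofReal (L + m * K / γ) := sum_toOuterMeasure_le B hfew

end Queries

/-! ### Estimates for parity states -/

section ParityEstimates

variable {N n : ℕ}

/-- The expectation value of an observable in the maximally mixed state. -/
noncomputable def normalizedTrace (O : Operator N) : ℝ :=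
  O.trace.re / 2 ^ N

theorem expect_diagonal (f : Bits N → ℝ) (ψ : StateVec N) :
    expect (diagonal fun z => (f z : ℂ)) ψ = ∑ z, f z * basisDist ψ z := by
  simp only [expect, dotProduct, mulVec_diagonal, Complex.re_sum, basisDist]
  refine Finset.sum_congr rfl fun z _ => ?_
  rw [Pi.star_apply, mul_left_comm, Complex.star_def, Complex.conj_mul', ← Complex.ofReal_pow,
    ← Complex.ofReal_mul, Complex.ofReal_re]

theorem expect_diagonal_parityState (f : Bits (n + 1) → ℝ) (s : Bits n) :
    expect (diagonal fun z => (f z : ℂ)) (parityState n s) =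
      normalizedTrace (diagonal fun z => (f z : ℂ)) +
        (∑ z, f z * paritySign s z) / 2 ^ (n + 1) := by
  simp only [expect_diagonal, basisDist_parityState, normalizedTrace, trace_diagonal,
    parityDist_eq_paritySign, Complex.re_sum, Complex.ofReal_re, ← add_div,
    ← Finset.sum_add_distrib, Finset.sum_div, mul_div_assoc', mul_add, mul_one]

open Classical in
theorem card_distinguishing_parityState_le {𝓜 : Set (Operator (n + 1))}
    (h𝓜 : 𝓜 ⊆ zBasisObservables (n + 1)) {τ : ℝ} (hτ : 0 < τ) (O : 𝓜) :
    (Finset.card {s | O ∈ distinguishing (fun O : 𝓜 => normalizedTrace (O : Operator (n + 1))) τ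
      (parityState n s)} : ℝ) ≤ 1 / τ ^ 2 := by
  obtain ⟨f, hf, hO⟩ := h𝓜 O.2
  have hpow : (0 : ℝ) < 2 ^ (n + 1) := by positivity
  have hcardBits : (Fintype.card (Bits (n + 1)) : ℝ) = 2 ^ (n + 1) := by simp
  have hbessel := card_mul_sq_le_of_le_norm_sum_mul_addChar (paritySign_injective (n := n))
    (S := {s | O ∈ distinguishing (fun O : 𝓜 => normalizedTrace (O : Operator (n + 1))) τ
      (parityState n s)})
    (f := f) (c := τ * 2 ^ (n + 1)) (by positivity) fun s hs => by
      rw [Finset.mem_filter_univ, distinguishing, Set.mem_ofPred_eq, hO,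
        expect_diagonal_parityState, sub_add_cancel_left, abs_neg, abs_div, abs_of_pos hpow,
        le_div_iff₀ hpow] at hs
      simpa only [conj_trivial, Real.norm_eq_abs] using hs
  have hnorm : ∑ z, ‖f z‖ ^ 2 ≤ 2 ^ (n + 1) := by
    rw [← hcardBits, ← Finset.card_univ, ← nsmul_one]
    exact Finset.sum_le_card_nsmul _ _ _ fun z _ => pow_le_one₀ (norm_nonneg _) (hf z)
  rw [hcardBits, mul_pow, ← mul_assoc] at hbessel
  rw [le_div_iff₀ (by positivity), ← mul_le_mul_iff_left₀ (pow_pos hpow 2)]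
  nlinarith

theorem SamplesFromEstimates.two_pow_mul_one_sub_le_of_parityCircuit {k m : ℕ} {τ ε δ γ : ℝ}
    {𝓜 : Set (Operator (n + 1))} {B : PMF (QueryAlgorithm 𝓜 (Fin k → Bits (n + 1)))}
    (hB : SamplesFromEstimates (Set.range (parityCircuit (n := n))) τ ε δ m B) (hk : 1 ≤ k)
    (h𝓜 : 𝓜 ⊆ zBasisObservables (n + 1)) (hτ : 0 < τ) (hγ : 0 < γ) (hγε : γ + ε < 1 / 2) :
    2 ^ n * (1 - δ) ≤ 2 / (1 - 2 * (γ + ε)) ^ 2 + m * (1 / τ ^ 2) / γ := by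
  classical
  have hbound := hB.card_mul_one_sub_le hτ ⟨0, hk⟩
    (e := fun O : 𝓜 => normalizedTrace (O : Operator (n + 1)))
    (K := 1 / τ ^ 2) (L := 2 / (1 - 2 * (γ + ε)) ^ 2) hγ
    (by simpa only [outputState_parityCircuit] using card_distinguishing_parityState_le h𝓜 hτ)
    (by simpa only [outputState_parityCircuit, basisDist_parityState] using
      card_tvDist_parityDist_le hγε)
  simpa using hbound

theorem eventually_add_mul_div_lt_two_pow_mul {τ : ℕ → ℝ} {m : ℕ → ℕ} (hτ : ∀ n, 0 < τ n)
    (hm : (fun n => (m n : ℝ)) =o[atTop] fun n => τ n ^ 2 * 2 ^ n) {a γ : ℝ} (ha : 0 < a)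
    (hγ : 0 < γ) (L : ℝ) :
    ∀ᶠ n in atTop, L + m n * (1 / τ n ^ 2) / γ < 2 ^ n * a := by
  have hL : ∀ᶠ n : ℕ in atTop, 2 * L / a < (2 : ℝ) ^ n :=
    (tendsto_pow_atTop_atTop_of_one_lt one_lt_two).eventually_gt_atTop _
  filter_upwards [hm.bound (show 0 < a * γ / 2 by positivity), hL] with n hmn hLn
  have hτn : 0 < τ n ^ 2 := pow_pos (hτ n) 2
  rw [Real.norm_of_nonneg (Nat.cast_nonneg _), Real.norm_of_nonneg (by positivity)] at hmn
  have hqueries : m n * (1 / τ n ^ 2) / γ ≤ 2 ^ n * (a / 2) := by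
    rw [div_le_iff₀ hγ, mul_one_div, div_le_iff₀ hτn]
    linarith
  rw [div_lt_iff₀ ha] at hLn
  linarith

end ParityEstimates

end WeakToStrong

theorem mainTheorem4_general :
    ∃ C : ∀ n : ℕ, Bits n → CliffordCircuit (n + 1),
      (∀ (n : ℕ) (s : Bits n), outputState (C n s) = parityState n s ∧
        basisDist (outputState (C n s)) = parityDist n s) ∧
      ∀ (τ : ℕ → ℝ) (m k : ℕ → ℕ) (ε δ : ℝ) (𝓜 : ∀ n : ℕ, Set (Operator (n + 1))),
        (∀ n, 0 < τ n) → (∀ n, 1 ≤ k n) → ε < 1 / 2 → δ < 1 →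
        (∀ n, 𝓜 n ⊆ zBasisObservables (n + 1)) →
        (fun n => (m n : ℝ)) =o[atTop] (fun n => τ n ^ 2 * 2 ^ n) →
        ∀ᶠ n in atTop, ¬ ∃ B : PMF (QueryAlgorithm (𝓜 n) (Fin (k n) → Bits (n + 1))),
          SamplesFromEstimates (Set.range (C n)) (τ n) ε δ (m n) B := by
  refine ⟨fun _ => parityCircuit, fun n s => ⟨outputState_parityCircuit s, ?_⟩, ?_⟩
  · rw [outputState_parityCircuit, basisDist_parityState]
  · intro τ m k ε δ 𝓜 hτ hk hε hδ h𝓜 hm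
    obtain ⟨γ, hγ, hγε⟩ : ∃ γ, 0 < γ ∧ γ < 1 / 2 - ε := exists_between (sub_pos.mpr hε)
    filter_upwards [eventually_add_mul_div_lt_two_pow_mul hτ hm (sub_pos.mpr hδ) hγ
      (2 / (1 - 2 * (γ + ε)) ^ 2)] with n hn
    rintro ⟨B, hB⟩
    exact hn.not_ge <| hB.two_pow_mul_one_sub_le_of_parityCircuit (hk n) (h𝓜 n) (hτ n) hγ
      (lt_sub_iff_add_lt.mp hγε)

theorem mainTheorem4 :
    ∃ C : ∀ n : ℕ, Bits n → CliffordCircuit (n + 1),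
      (∀ (n : ℕ) (s : Bits n), outputState (C n s) = parityState n s ∧
        basisDist (outputState (C n s)) = parityDist n s) ∧
      ∀ (τ : ℕ → ℝ) (m k : ℕ → ℕ) (δ : ℝ) (𝓜 : ∀ n : ℕ, Set (Operator (n + 1))),
        (∀ n, 0 < τ n) → (∀ n, 1 ≤ k n) → δ < 1 →
        (∀ n, 𝓜 n ⊆ zBasisObservables (n + 1)) →
        (fun n => (m n : ℝ)) =o[atTop] (fun n => τ n ^ 2 * 2 ^ n) →
        ∀ᶠ n in atTop, ¬ ∃ B : PMF (QueryAlgorithm (𝓜 n) (Fin (k n) → Bits (n + 1))),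
          SamplesFromEstimates (Set.range (C n)) (τ n) (1 / 16) δ (m n) B := by
  obtain ⟨C, hC, hbound⟩ := mainTheorem4_general
  exact ⟨C, hC, fun τ m k δ 𝓜 hτ hk => hbound τ m k (1 / 16) δ 𝓜 hτ hk (by norm_num)⟩
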